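/- Let $(Q_n)_{n\ge 0}$ be the Yablonskii--Vorob'ev polynomials, defined by $Q_0=1$, $Q_1=z$ and $$Q_{n+1}Q_{n-1}=zQ_n^2-4\bigl(Q_nQ_n''-(Q_n')^2\bigr)\qquad(n\ge 1).$$ These equations do define a sequence of polynomials; $Q_n$ has $\tfrac12 n(n+1)$ complex roots $z_{n,k}$, $1\le k\le \tfrac12 n(n+1)$ (listed with multiplicity), and for $n\ge1$ the polynomials $Q_{n-1}$ and $Q_n$ have no common root. Moreover, for every $n\ge 1$: For $1\le j\le \tfrac12 n(n-1)$, $$\sum_{k=1}^{\frac12 n(n+1)}\frac{1}{(z_{n-1,j}-z_{n,k})^2}=-\frac{z_{n-1,j}}{4},\qquad \sum_{k=1}^{\frac12 n(n+1)}\frac{1}{(z_{n-1,j}-z_{n,k})^3}=\frac{n+1}{4},$$ $$\sum_{k=1}^{\frac12 n(n+1)}\frac{1}{(z_{n-1,j}-z_{n,k})^5}=-z_{n-1,j}\left(\frac{n+1}{24}-\frac1{48}\right).$$ For $1\le j\le \tfrac12 n(n+1)$, $$\sum_{k=1}^{\frac12 n(n-1)}\frac{1}{(z_{n,j}-z_{n-1,k})^2}=-\frac{z_{n,j}}{4},\qquad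 \sum_{k=1}^{\frac12 n(n-1)}\frac{1}{(z_{n,j}-z_{n-1,k})^3}=-\frac{n-1}{4},$$ $$\sum_{k=1}^{\frac12 n(n-1)}\frac{1}{(z_{n,j}-z_{n-1,k})^5}=z_{n,j}\left(\frac{n-1}{24}+\frac1{48}\right).$$ -/

import Mathlib

open Polynomial

/-- The Yablonskii--Vorob'ev polynomials `Q_n`, with `Q_0 = 1`, `Q_1 = z` and
`Q_{n+1} = (z Q_n^2 - 4 (Q_n Q_n'' - (Q_n')^2)) / Q_{n-1}`.
Here `/` is Euclidean division of polynomials. That the division is exact, so that the defining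
equation `Q_{n+1} Q_{n-1} = z Q_n^2 - 4 (Q_n Q_n'' - (Q_n')^2)` really holds,
is asserted as part of the theorem. -/
noncomputable def yablonskiiVorobev : ℕ → ℂ[X]
  | 0 => 1
  | 1 => X
  | n + 2 =>
      (X * yablonskiiVorobev (n + 1) ^ 2
        - 4 * (yablonskiiVorobev (n + 1) * derivative (derivative (yablonskiiVorobev (n + 1)))
          - derivative (yablonskiiVorobev (n + 1)) ^ 2))
      / yablonskiiVorobev n

/-- `rootSum n s z` is the sum of `1 / (z - w) ^ s` over all roots `w` of `Q_n`,
counted with multiplicity. -/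
noncomputable def rootSum (n s : ℕ) (z : ℂ) : ℂ :=
  ((yablonskiiVorobev n).roots.map fun w => 1 / (z - w) ^ s).sum

/-! Put `f = Q_{n-1}`, `g = Q_n`, `φ = f / g`, `G = g' / g`. The two Hirota equations with `ν = n`
say that `φ'' = -2 G' φ` and `(4 G' - z) φ' = (2 G'' + ν) φ` (`isHirotaPair_iff`). At a root of `f`
which is not a root of `g`, `φ` has a simple zero, since a double zero would force `φ = 0` by
uniqueness for the linear equation. Comparing Taylor coefficients there determines those of `G`,
which up to sign are the required sums over the roots of `g` (`IsHirotaPair.root_sums`). Exchanging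
`f` and `g` replaces `ν` by `-ν` and gives the other three sums.

The Hirota equations propagate along the recurrence by a Bäcklund transformation
(`IsHirotaPair.step`). Exactness of the division comes from the same local analysis: the roots of
`f` are simple, and the second-power sum makes the numerator vanish at each of them. -/

/-! ### Hirota equations and the Bäcklund transformation -/

section Hirota

variable {A : Type*} [CommRing A] [Algebra ℂ A]

/-- The pair of bilinear (Hirota) equations `D² f·g = 0` and `D³ f·g = z D f·g + ν f g`. -/
structure IsHirotaPair (δ : Derivation ℂ A A) (z ν f g : A) : Prop where
  second : δ (δ f) * g - 2 * (δ f * δ g) + f * δ (δ g) = 0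
  third : δ (δ (δ f)) * g - 3 * (δ (δ f) * δ g) + 3 * (δ f * δ (δ g)) - f * δ (δ (δ g)) =
    z * (δ f * g - f * δ g) + ν * (f * g)

theorem IsHirotaPair.symm {δ : Derivation ℂ A A} {z ν f g : A} (h : IsHirotaPair δ z ν f g) :
    IsHirotaPair δ z (-ν) g f :=
  ⟨by linear_combination h.second, by linear_combination -h.third⟩

/-- The right-hand side of the Yablonskii--Vorob'ev recurrence. -/
def todaNumerator (δ : Derivation ℂ A A) (z g : A) : A :=
  z * g ^ 2 - 4 * (g * δ (δ g) - δ g ^ 2)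

/-- For `f = g φ` and `u = 2 (log g)''`, the Hirota equations say that `φ'' = - u φ` and
`(2 u - z) φ' = (u' + ν) φ`. -/
theorem isHirotaPair_iff [IsDomain A] (δ : Derivation ℂ A A) {z ν f g φ G : A} (hg : g ≠ 0)
    (hf : f = g * φ) (hG : δ g = g * G) :
    IsHirotaPair δ z ν f g ↔
      δ (δ φ) = -(2 * δ G * φ) ∧ (4 * δ G - z) * δ φ = (2 * δ (δ G) + ν) * φ := by
  have f1 : δ f = g * (G * φ + δ φ) := by
    rw [hf]; simp only [Derivation.leibniz, smul_eq_mul, hG]; ring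
  have f2 : δ (δ f) = g * (G ^ 2 * φ + 2 * G * δ φ + δ G * φ + δ (δ φ)) := by
    rw [f1]; simp only [Derivation.leibniz, smul_eq_mul, hG, map_add]; ring
  have f3 : δ (δ (δ f)) = g * (G ^ 3 * φ + 3 * G ^ 2 * δ φ + 3 * G * δ G * φ + 3 * δ G * δ φ
      + 3 * G * δ (δ φ) + δ (δ G) * φ + δ (δ (δ φ))) := by
    rw [f2]
    have h2 : δ 2 = 0 := by exact_mod_cast δ.map_natCast 2
    simp only [Derivation.leibniz, Derivation.leibniz_pow, smul_eq_mul, nsmul_eq_mul, hG,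
      map_add, h2]
    push_cast; ring
  have g2 : δ (δ g) = g * (G ^ 2 + δ G) := by
    rw [hG]; simp only [Derivation.leibniz, smul_eq_mul, hG]; ring
  have g3 : δ (δ (δ g)) = g * (G ^ 3 + 3 * G * δ G + δ (δ G)) := by
    rw [g2]
    simp only [Derivation.leibniz, Derivation.leibniz_pow, smul_eq_mul, nsmul_eq_mul, hG, map_add]
    push_cast; ring
  have second : δ (δ f) * g - 2 * (δ f * δ g) + f * δ (δ g) =
      g ^ 2 * (δ (δ φ) + 2 * δ G * φ) := by
    rw [f2, f1, g2, hG, hf]; ring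
  have third : δ (δ (δ f)) * g - 3 * (δ (δ f) * δ g) + 3 * (δ f * δ (δ g)) - f * δ (δ (δ g)) -
      (z * (δ f * g - f * δ g) + ν * (f * g)) =
      g ^ 2 * (δ (δ (δ φ)) + 6 * δ G * δ φ - z * δ φ - ν * φ) := by
    rw [f3, f2, f1, g3, g2, hG, hf]; ring
  have φ3 (h : δ (δ φ) = -(2 * δ G * φ)) :
      δ (δ (δ φ)) = -(2 * δ (δ G) * φ + 2 * δ G * δ φ) := by
    have h2 : δ 2 = 0 := by exact_mod_cast δ.map_natCast 2
    rw [h]; simp only [Derivation.leibniz, smul_eq_mul, map_neg, h2]; ring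
  have hg2 : g ^ 2 ≠ 0 := pow_ne_zero 2 hg
  constructor
  · rintro ⟨h1, h2⟩
    have h1' : δ (δ φ) = -(2 * δ G * φ) := by
      rw [second] at h1
      linear_combination (mul_eq_zero.mp h1).resolve_left hg2
    rw [← sub_eq_zero, third] at h2
    refine ⟨h1', ?_⟩
    linear_combination (mul_eq_zero.mp h2).resolve_left hg2 - φ3 h1'
  · rintro ⟨h1, h2⟩
    refine ⟨by rw [second, h1]; ring, ?_⟩
    rw [← sub_eq_zero, third, φ3 h1]
    linear_combination g ^ 2 * h2

theorem todaNumerator_eq (δ : Derivation ℂ A A) {z g G : A} (hG : δ g = g * G) :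
    todaNumerator δ z g = -(g ^ 2 * (4 * δ G - z)) := by
  have g2 : δ (δ g) = g * (G ^ 2 + δ G) := by
    rw [hG]; simp only [Derivation.leibniz, smul_eq_mul, hG]; ring
  rw [todaNumerator, g2, hG]; ring

/-- The Bäcklund transformation: the Yablonskii--Vorob'ev recurrence carries a solution of the
Hirota equations with parameter `ν` to one with parameter `ν + 1`. -/
theorem IsHirotaPair.step [IsDomain A] {δ : Derivation ℂ A A} {z ν f g h φ ψ G : A}
    (H : IsHirotaPair δ z ν f g) (hz : δ z = 1) (hν : δ ν = 0) (hg : g ≠ 0)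
    (hf : f = g * φ) (hh : h = g * ψ) (hG : δ g = g * G)
    (hN : h * f = todaNumerator δ z g) (hN0 : todaNumerator δ z g ≠ 0) :
    IsHirotaPair δ z (ν + 1) g h := by
  obtain ⟨h1, h2⟩ := (isHirotaPair_iff δ hg hf hG).mp H
  rw [todaNumerator_eq δ hG] at hN hN0
  -- The recurrence divided by `g ^ 2`; below, `ψ = h / g` is shown to solve the same Schrödinger
  -- equation as `φ`.
  have hφψ : φ * ψ = -(4 * δ G - z) := by
    refine mul_left_cancel₀ (pow_ne_zero 2 hg) ?_
    rw [hf, hh] at hN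
    linear_combination hN
  have hφ : φ ≠ 0 := by
    rintro rfl
    exact hN0 (by linear_combination -(g ^ 2 * hφψ))
  generalize hv : 4 * δ G - z = v at *
  have hv0 : v ≠ 0 := fun h0 => hN0 (by rw [h0]; ring)
  have hv1 : δ v = 4 * δ (δ G) - 1 := by
    have h4 : δ 4 = 0 := by exact_mod_cast δ.map_natCast 4
    rw [← hv]; simp only [Derivation.leibniz, smul_eq_mul, map_sub, h4, hz]; ring
  have hv2 : δ (δ v) = 4 * δ (δ (δ G)) := by
    have h4 : δ 4 = 0 := by exact_mod_cast δ.map_natCast 4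
    rw [hv1]; simp only [Derivation.leibniz, smul_eq_mul, map_sub, h4, Derivation.map_one_eq_zero]
    ring
  have d1 : δ φ * ψ + φ * δ ψ = -δ v := by
    have := congrArg δ hφψ
    simp only [Derivation.leibniz, smul_eq_mul, map_neg] at this
    linear_combination this
  have d2 : δ (δ φ) * ψ + 2 * (δ φ * δ ψ) + φ * δ (δ ψ) = -δ (δ v) := by
    have := congrArg δ d1
    simp only [Derivation.leibniz, smul_eq_mul, map_neg, map_add] at this
    linear_combination this
  have e2 : v * δ ψ = (2 * δ (δ G) - (ν + 1)) * ψ := by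
    refine mul_left_cancel₀ hφ ?_
    linear_combination v * d1 - ψ * h2 - δ v * hφψ + φ * ψ * hv1
  have d3 : (4 * δ (δ G) - 1) * δ φ + v * δ (δ φ) =
      2 * δ (δ (δ G)) * φ + (2 * δ (δ G) + ν) * δ φ := by
    have h22 : δ 2 = 0 := by exact_mod_cast δ.map_natCast 2
    have := congrArg δ h2
    simp only [Derivation.leibniz, smul_eq_mul, map_add, hν, h22, hv1] at this
    linear_combination this
  -- Compatibility of the two equations for `φ`: differentiate the first-order one and eliminate
  -- `φ''` and `φ'`. What remains is a nonlinear equation for `G` alone.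
  have d4 : (2 * δ (δ G) - 1 - ν) * (2 * δ (δ G) + ν) - 2 * δ G * v ^ 2 =
      2 * δ (δ (δ G)) * v := by
    refine mul_left_cancel₀ hφ ?_
    linear_combination v * d3 - v ^ 2 * h1 - (2 * δ (δ G) - 1 - ν) * h2
  have e1 : δ (δ ψ) = -(2 * δ G * ψ) := by
    refine mul_left_cancel₀ (mul_ne_zero (pow_ne_zero 2 hv0) hφ) ?_
    have e3 : v ^ 2 * (δ φ * δ ψ) =
        (2 * δ (δ G) + ν) * (2 * δ (δ G) - (ν + 1)) * -v := by
      linear_combination v * δ φ * e2 + (2 * δ (δ G) - (ν + 1)) * ψ * h2 +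
        (2 * δ (δ G) + ν) * (2 * δ (δ G) - (ν + 1)) * hφψ
    linear_combination v ^ 2 * d2 - 2 * e3 - v ^ 2 * ψ * h1 + 4 * v ^ 2 * δ G * hφψ - v ^ 2 * hv2
      + 2 * v * d4
  have := ((isHirotaPair_iff (ν := -(ν + 1)) δ hg hh hG).mpr
    ⟨e1, by rw [hv]; linear_combination e2⟩).symm
  rwa [neg_neg] at this

end Hirota

/-! ### Taylor expansions and logarithmic derivatives -/

section Germ

/-- The Taylor expansion of a polynomial at a point, as a power series. -/
noncomputable def germ (z : ℂ) : ℂ[X] →+* PowerSeries ℂ :=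
  Polynomial.coeToPowerSeries.ringHom.comp (taylorAlgHom z : ℂ[X] →ₐ[ℂ] ℂ[X]).toRingHom

theorem germ_apply (z : ℂ) (p : ℂ[X]) : germ z p = (taylor z p : PowerSeries ℂ) := rfl

theorem germ_injective (z : ℂ) : Function.Injective (germ z) := fun _ _ h =>
  taylor_injective z (Polynomial.coe_injective ℂ h)

theorem derivative_germ (z : ℂ) (p : ℂ[X]) :
    PowerSeries.derivative ℂ (germ z p) = germ z (derivative p) := by
  rw [germ_apply, germ_apply, PowerSeries.derivative_coe, taylor_apply, taylor_apply,
    derivative_comp]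
  simp

theorem constantCoeff_germ (z : ℂ) (p : ℂ[X]) :
    PowerSeries.constantCoeff (germ z p) = p.eval z := by
  rw [germ_apply, ← PowerSeries.coeff_zero_eq_constantCoeff_apply, Polynomial.coeff_coe,
    taylor_coeff_zero]

theorem germ_X (z : ℂ) : germ z X = PowerSeries.X + PowerSeries.C z := by
  rw [germ_apply, taylor_X]; simp

theorem germ_C (z a : ℂ) : germ z (C a) = PowerSeries.C a := by
  rw [germ_apply, taylor_C, Polynomial.coe_C]

theorem isHirotaPair_germ_iff (z : ℂ) {ν : ℂ} {f g : ℂ[X]} :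
    IsHirotaPair (PowerSeries.derivative ℂ) (germ z X) (germ z (C ν)) (germ z f) (germ z g) ↔
      IsHirotaPair derivative' X (C ν) f g := by
  constructor
  · rintro ⟨h1, h2⟩
    simp only [derivative_germ] at h1 h2
    refine ⟨germ_injective z ?_, germ_injective z ?_⟩
    · simpa [derivative', map_ofNat] using h1
    · simpa [derivative', map_ofNat] using h2
  · rintro ⟨h1, h2⟩
    have h1' := congrArg (germ z) h1
    have h2' := congrArg (germ z) h2
    refine ⟨?_, ?_⟩ <;> simp only [derivative_germ]
    · simpa [derivative', map_ofNat] using h1'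
    · simpa [derivative', map_ofNat] using h2'

theorem todaNumerator_germ (z : ℂ) (g : ℂ[X]) :
    todaNumerator (PowerSeries.derivative ℂ) (germ z X) (germ z g) =
      germ z (todaNumerator derivative' X g) := by
  simp [todaNumerator, derivative_germ, derivative', map_ofNat]

theorem IsHirotaPair.symm_C {ν : ℂ} {f g : ℂ[X]} (H : IsHirotaPair derivative' X (C ν) f g) :
    IsHirotaPair derivative' X (C (-ν)) g f := by
  rw [C_neg]
  exact H.symm

theorem isUnit_germ {z : ℂ} {g : ℂ[X]} (hg : g.eval z ≠ 0) : IsUnit (germ z g) := by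
  rw [PowerSeries.isUnit_iff_constantCoeff, constantCoeff_germ]
  exact hg.isUnit

/-- The expansion of `g' / g` at `z`, written in terms of the roots of `g`. -/
noncomputable def logDerivSeries (s : Multiset ℂ) (z : ℂ) : PowerSeries ℂ :=
  PowerSeries.mk fun k => (-1) ^ k * (s.map fun w => 1 / (z - w) ^ (k + 1)).sum

/-- Logarithmic derivatives add over factors, and a linear factor contributes the geometric series
of `1 / (X + (z - w))`. -/
theorem derivative_germ_prod (z : ℂ) (s : Multiset ℂ) (hs : ∀ w ∈ s, z ≠ w) :
    PowerSeries.derivative ℂ (germ z (s.map fun w => X - C w).prod) =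
      germ z (s.map fun w => X - C w).prod * logDerivSeries s z := by
  induction s using Multiset.induction_on with
  | empty =>
    have : logDerivSeries 0 z = 0 := by ext k; simp [logDerivSeries]
    simp [this]
  | cons a s ih =>
    have hza : z - a ≠ 0 := sub_ne_zero.mpr (hs a (Multiset.mem_cons_self a s))
    have hsplit : logDerivSeries (a ::ₘ s) z = logDerivSeries {a} z + logDerivSeries s z := by
      ext k; simp [logDerivSeries, mul_add]
    have hlin : germ z (X - C a) * logDerivSeries {a} z = 1 := by
      have : germ z (X - C a) = PowerSeries.X + PowerSeries.C (z - a) := by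
        rw [map_sub, germ_X, germ_C, map_sub]; ring
      rw [this]
      ext k
      rw [add_mul, map_add, PowerSeries.coeff_C_mul]
      cases k with
      | zero => simp [logDerivSeries, hza]
      | succ k =>
        rw [PowerSeries.coeff_succ_X_mul]
        simp only [logDerivSeries, PowerSeries.coeff_mk, Multiset.map_singleton,
          Multiset.sum_singleton, PowerSeries.coeff_one]
        simp only [Nat.add_eq_zero_iff, one_ne_zero, and_false, if_false]
        field_simp
        ring
    have hd : PowerSeries.derivative ℂ (germ z (X - C a)) = 1 := by
      rw [derivative_germ]; simp
    simp only [Multiset.map_cons, Multiset.prod_cons, map_mul, Derivation.leibniz, smul_eq_mul]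
    rw [ih fun w hw => hs w (Multiset.mem_cons_of_mem hw), hd, hsplit]
    linear_combination -(germ z (s.map fun w => X - C w).prod) * hlin

theorem derivative_germ_eq_mul_logDerivSeries {z : ℂ} {g : ℂ[X]} (hg : g.eval z ≠ 0) :
    PowerSeries.derivative ℂ (germ z g) = germ z g * logDerivSeries g.roots z := by
  have hs : ∀ w ∈ g.roots, z ≠ w := by
    rintro w hw rfl
    exact hg (isRoot_of_mem_roots hw)
  have hprod := (IsAlgClosed.splits g).eq_prod_roots
  have := derivative_germ_prod z g.roots hs
  have e : germ z g = PowerSeries.C g.leadingCoeff * germ z (g.roots.map fun w => X - C w).prod := by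
    conv_lhs => rw [hprod]
    rw [map_mul, germ_C]
  rw [e, Derivation.leibniz, this]
  simp only [smul_eq_mul, PowerSeries.derivative_C]
  ring

end Germ

/-! ### Local analysis at a root of the first member -/

section Local

/-- The ratio `φ` of the two members of a Hirota pair near a point where the second one does not
vanish, with the equations it satisfies. -/
theorem IsHirotaPair.exists_ratio {ν : ℂ} {f g : ℂ[X]}
    (H : IsHirotaPair derivative' X (C ν) f g) {z : ℂ} (hg : g.eval z ≠ 0) :
    ∃ φ : PowerSeries ℂ, germ z f = germ z g * φ ∧
      PowerSeries.derivative ℂ (PowerSeries.derivative ℂ φ) =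
        -(2 * PowerSeries.derivative ℂ (logDerivSeries g.roots z) * φ) ∧
      (4 * PowerSeries.derivative ℂ (logDerivSeries g.roots z) -
          (PowerSeries.X + PowerSeries.C z)) * PowerSeries.derivative ℂ φ =
        (2 * PowerSeries.derivative ℂ (PowerSeries.derivative ℂ (logDerivSeries g.roots z)) +
          PowerSeries.C ν) * φ := by
  obtain ⟨φ, hφ⟩ := (isUnit_germ hg).dvd (a := germ z f)
  have := (isHirotaPair_iff _ (isUnit_germ hg).ne_zero hφ
    (derivative_germ_eq_mul_logDerivSeries hg)).mp ((isHirotaPair_germ_iff z).mpr H)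
  rw [germ_X, germ_C] at this
  exact ⟨φ, hφ, this⟩

/-- The equation expresses coefficient `n + 2` of `φ` through those of index at most `n`. -/
theorem eq_zero_of_linear_ode {φ u : PowerSeries ℂ}
    (h : PowerSeries.derivative ℂ (PowerSeries.derivative ℂ φ) = -(u * φ))
    (h0 : PowerSeries.coeff 0 φ = 0) (h1 : PowerSeries.coeff 1 φ = 0) : φ = 0 := by
  have key : ∀ n, PowerSeries.coeff n φ = 0 := by
    intro n
    induction n using Nat.strong_induction_on with
    | _ n ih =>
      match n with
      | 0 => exact h0
      | 1 => exact h1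
      | n + 2 =>
        have := congrArg (PowerSeries.coeff n) h
        have hsum : PowerSeries.coeff n (u * φ) = 0 := by
          rw [PowerSeries.coeff_mul]
          refine Finset.sum_eq_zero fun p hp => ?_
          rw [Finset.HasAntidiagonal.mem_antidiagonal] at hp
          rw [ih p.2 (by omega), mul_zero]
        rw [PowerSeries.coeff_derivative, PowerSeries.coeff_derivative, map_neg, hsum,
          neg_zero] at this
        have a1 : ((n + 1 : ℕ) : ℂ) + 1 ≠ 0 := by exact_mod_cast Nat.succ_ne_zero (n + 1)
        have a2 : (n : ℂ) + 1 ≠ 0 := by exact_mod_cast Nat.succ_ne_zero n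
        exact (mul_eq_zero.mp ((mul_eq_zero.mp this).resolve_right a2)).resolve_right a1
  ext n
  simp [key n]

variable {ν z : ℂ} {f g : ℂ[X]}

theorem coeff_ratio_ne_zero {φ u : PowerSeries ℂ} (hf0 : f ≠ 0)
    (hφ : germ z f = germ z g * φ)
    (hode : PowerSeries.derivative ℂ (PowerSeries.derivative ℂ φ) = -(u * φ))
    (h0 : PowerSeries.coeff 0 φ = 0) : PowerSeries.coeff 1 φ ≠ 0 := by
  intro h1
  rw [eq_zero_of_linear_ode hode h0 h1, mul_zero] at hφ
  exact hf0 (germ_injective z (by rw [hφ, map_zero]))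

theorem coeff_zero_ratio {φ : PowerSeries ℂ} (hφ : germ z f = germ z g * φ)
    (hf : f.eval z = 0) (hg : g.eval z ≠ 0) : PowerSeries.coeff 0 φ = 0 := by
  have := congrArg PowerSeries.constantCoeff hφ
  rw [map_mul, constantCoeff_germ, constantCoeff_germ, hf] at this
  simpa [hg] using this.symm

/-- Roots of the first member of a Hirota pair that are not roots of the second are simple. -/
theorem IsHirotaPair.eval_derivative_ne_zero (H : IsHirotaPair derivative' X (C ν) f g)
    (hf0 : f ≠ 0) (hf : f.eval z = 0) (hg : g.eval z ≠ 0) : (derivative f).eval z ≠ 0 := by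
  obtain ⟨φ, hφ, hode, -⟩ := H.exists_ratio hg
  have h0 := coeff_zero_ratio hφ hf hg
  have h1 := coeff_ratio_ne_zero hf0 hφ hode h0
  rw [← constantCoeff_germ, ← derivative_germ, hφ]
  simp only [Derivation.leibniz, smul_eq_mul, map_add, map_mul, constantCoeff_germ]
  rw [← PowerSeries.coeff_zero_eq_constantCoeff_apply φ, h0, zero_mul, add_zero,
    ← PowerSeries.coeff_zero_eq_constantCoeff_apply, PowerSeries.coeff_derivative]
  simpa [hg] using h1

/-- The sums over the roots of the second member of a Hirota pair, at a root of the first. -/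
theorem IsHirotaPair.root_sums (H : IsHirotaPair derivative' X (C ν) f g)
    (hf0 : f ≠ 0) (hf : f.eval z = 0) (hg : g.eval z ≠ 0) :
    (g.roots.map fun w => 1 / (z - w) ^ 2).sum = -(z / 4) ∧
      (g.roots.map fun w => 1 / (z - w) ^ 3).sum = (ν + 1) / 4 ∧
      (g.roots.map fun w => 1 / (z - w) ^ 5).sum = -(z * (2 * ν + 1) / 48) := by
  obtain ⟨φ, hφ, hode, hfst⟩ := H.exists_ratio hg
  have h0 := coeff_zero_ratio hφ hf hg
  have h1 := coeff_ratio_ne_zero hf0 hφ hode h0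
  have c1 : PowerSeries.coeff 1 (logDerivSeries g.roots z) =
      -(g.roots.map fun w => 1 / (z - w) ^ 2).sum := by simp [logDerivSeries]
  have c2 : PowerSeries.coeff 2 (logDerivSeries g.roots z) =
      (g.roots.map fun w => 1 / (z - w) ^ 3).sum := by simp [logDerivSeries]
  have c4 : PowerSeries.coeff 4 (logDerivSeries g.roots z) =
      (g.roots.map fun w => 1 / (z - w) ^ 5).sum := by
    simp [logDerivSeries, show ((-1 : ℂ)) ^ 4 = 1 by norm_num]
  generalize logDerivSeries g.roots z = G at *
  have two : (2 : PowerSeries ℂ) = PowerSeries.C 2 := (map_ofNat PowerSeries.C 2).symm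
  have four : (4 : PowerSeries ℂ) = PowerSeries.C 4 := (map_ofNat PowerSeries.C 4).symm
  rw [two] at hode hfst
  rw [four] at hfst
  have o (k : ℕ) := congrArg (PowerSeries.coeff k) hode
  have e (k : ℕ) := congrArg (PowerSeries.coeff k) hfst
  simp only [PowerSeries.coeff_mul, Finset.Nat.sum_antidiagonal_eq_sum_range_succ_mk,
    map_add, map_sub, map_neg, PowerSeries.coeff_derivative, PowerSeries.coeff_X,
    PowerSeries.coeff_C] at o e
  have o0 := o 0
  have o1 := o 1
  have e0 := e 0
  have e1 := e 1
  -- Order 2 of the first-order equation is skipped: it reduces to `12 G₃ φ₁ = 12 G₃ φ₁`, which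
  -- leaves the fourth-power sum undetermined.
  have e3 := e 3
  simp [Finset.sum_range_succ, -PowerSeries.coeff_zero_eq_constantCoeff, h0] at o0 o1 e0 e1 e3
  replace e0 := e0.resolve_right h1
  have G1 : PowerSeries.coeff 1 G = z / 4 := by linear_combination e0 / 4
  rw [o0] at e1 e3
  have G2 : PowerSeries.coeff 2 G = (ν + 1) / 4 := by
    refine mul_right_cancel₀ h1 ?_
    linear_combination e1 / 4
  have G4 : PowerSeries.coeff 4 G = -(z * (2 * ν + 1) / 48) := by
    refine mul_right_cancel₀ h1 ?_
    rw [G1] at o1 e3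
    rw [G2] at e3
    -- Order 3 reads `8 G₄ φ₁ = 2 (2 ν + 1) φ₃`, and `o1` gives `φ₃ = -(z / 12) φ₁`.
    linear_combination (-1 / 8) * e3 + (2 * ν + 1) / 24 * o1
  refine ⟨?_, c2.symm.trans G2, c4.symm.trans G4⟩
  linear_combination -(c1.symm.trans G1)

end Local

/-! ### Exact division and the inductive step for polynomials -/

section Step

variable {f g : ℂ[X]}

theorem todaNumerator_monic (hg : g.Monic) :
    (todaNumerator derivative' X g).Monic ∧
      (todaNumerator derivative' X g).natDegree = 2 * g.natDegree + 1 := by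
  have hlead : (X * g ^ 2).Monic := monic_X.mul (hg.pow 2)
  have hdeg : (X * g ^ 2).natDegree = 2 * g.natDegree + 1 := by
    rw [monic_X.natDegree_mul (hg.pow 2), hg.natDegree_pow, natDegree_X]; ring
  have hlow : (4 * (g * derivative (derivative g) - derivative g ^ 2)).natDegree ≤
      2 * g.natDegree := by
    have h1 : (derivative g).natDegree ≤ g.natDegree :=
      (natDegree_derivative_le g).trans (Nat.sub_le _ _)
    have h2 : (derivative (derivative g)).natDegree ≤ g.natDegree :=
      ((natDegree_derivative_le _).trans (Nat.sub_le _ _)).trans h1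
    have h4 : (4 : ℂ[X]).natDegree = 0 := natDegree_ofNat 4
    refine natDegree_mul_le.trans ?_
    rw [h4, zero_add]
    have h5 := natDegree_mul_le (p := g) (q := derivative (derivative g))
    have h6 := natDegree_pow_le (p := derivative g) (n := 2)
    exact (natDegree_sub_le _ _).trans (max_le (by omega) (by omega))
  have hlt : (4 * (g * derivative (derivative g) - derivative g ^ 2)).natDegree <
      (X * g ^ 2).natDegree := by omega
  constructor
  · exact hlead.sub_of_left (degree_lt_degree hlt)
  · exact (natDegree_sub_eq_left_of_natDegree_lt hlt).trans hdeg

theorem IsHirotaPair.dvd_todaNumerator {ν : ℂ} (H : IsHirotaPair derivative' X (C ν) f g)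
    (hf : f ≠ 0) (hg : g.Monic) (hfg : ∀ z, f.eval z = 0 → g.eval z ≠ 0) :
    f ∣ todaNumerator derivative' X g := by
  refine (IsAlgClosed.splits f).dvd_of_roots_le_roots hf ?_
  -- With simple roots, divisibility only requires the numerator to vanish at each root of `f`.
  have hnodup : f.roots.Nodup := by
    rw [Multiset.nodup_iff_count_le_one]
    intro z
    rw [count_roots]
    by_contra! h
    obtain ⟨h0, h1⟩ := (one_lt_rootMultiplicity_iff_isRoot hf).mp h
    exact H.eval_derivative_ne_zero hf h0 (hfg z h0) h1
  rw [Multiset.le_iff_subset hnodup]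
  intro z hz
  have h0 : f.eval z = 0 := isRoot_of_mem_roots hz
  rw [mem_roots (todaNumerator_monic hg).1.ne_zero, IsRoot, ← constantCoeff_germ, ← todaNumerator_germ,
    todaNumerator_eq _ (derivative_germ_eq_mul_logDerivSeries (hfg z h0)), germ_X]
  have := (H.root_sums hf h0 (hfg z h0)).1
  rw [map_neg, map_mul, neg_eq_zero, mul_eq_zero]
  right
  have four : (4 : PowerSeries ℂ) = PowerSeries.C 4 := (map_ofNat PowerSeries.C 4).symm
  rw [four, map_sub, map_mul,
    ← PowerSeries.coeff_zero_eq_constantCoeff_apply (PowerSeries.derivative ℂ _),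
    PowerSeries.coeff_derivative]
  simp [logDerivSeries] at this ⊢
  rw [this]; ring

/-- The ratios `f / g` and `h / g` are not polynomials in general, so the transformation is applied
to Taylor series at a point where `g` is nonzero; injectivity of `germ` brings the equations back.
-/
theorem IsHirotaPair.step_polynomial {ν : ℂ} {h : ℂ[X]}
    (H : IsHirotaPair derivative' X (C ν) f g) (hg : g.Monic)
    (hN : h * f = todaNumerator derivative' X g) :
    IsHirotaPair derivative' X (C (ν + 1)) g h := by
  obtain ⟨z, hz⟩ : ∃ z, g.eval z ≠ 0 := by
    by_contra! h0
    exact hg.ne_zero (Polynomial.funext fun z => by rw [h0 z, eval_zero])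
  have hu := isUnit_germ hz
  obtain ⟨φ, hφ⟩ := hu.dvd (a := germ z f)
  obtain ⟨ψ, hψ⟩ := hu.dvd (a := germ z h)
  rw [← isHirotaPair_germ_iff z, map_add, map_add, map_one, map_one]
  refine ((isHirotaPair_germ_iff z).mpr H).step ?_ ?_ hu.ne_zero hφ hψ
    (derivative_germ_eq_mul_logDerivSeries hz) ?_ ?_
  · simp [derivative_germ]
  · simp [derivative_germ]
  · rw [todaNumerator_germ, ← hN, map_mul]
  · rw [todaNumerator_germ]
    exact (map_ne_zero_iff _ (germ_injective z)).mpr (todaNumerator_monic hg).1.ne_zero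

end Step

/-! ### Induction along the sequence -/

section YablonskiiVorobev

theorem yablonskiiVorobev_add_two (n : ℕ) :
    yablonskiiVorobev (n + 2) =
      todaNumerator derivative' X (yablonskiiVorobev (n + 1)) / yablonskiiVorobev n := by
  rw [yablonskiiVorobev]; rfl

/-- All clauses are proved together: the exact recurrence carries the Hirota equations and
coprimality to the next pair, and these make the next division exact. -/
theorem yablonskiiVorobev_properties (n : ℕ) :
    ((yablonskiiVorobev n).Monic ∧ (yablonskiiVorobev n).natDegree = n * (n + 1) / 2) ∧
    ((yablonskiiVorobev (n + 1)).Monic ∧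
      (yablonskiiVorobev (n + 1)).natDegree = (n + 1) * (n + 2) / 2) ∧
    (∀ z, (yablonskiiVorobev n).eval z = 0 → (yablonskiiVorobev (n + 1)).eval z ≠ 0) ∧
    IsHirotaPair derivative' X (C ((n : ℂ) + 1)) (yablonskiiVorobev n)
      (yablonskiiVorobev (n + 1)) ∧
    yablonskiiVorobev (n + 2) * yablonskiiVorobev n =
      todaNumerator derivative' X (yablonskiiVorobev (n + 1)) := by
  induction n with
  | zero =>
    have h0 : yablonskiiVorobev 0 = 1 := by rw [yablonskiiVorobev]
    have h1 : yablonskiiVorobev 1 = X := by rw [yablonskiiVorobev]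
    refine ⟨by simp [h0], by simp [h1], by simp [h0], ⟨?_, ?_⟩, ?_⟩
    · simp [h0, h1, derivative']
    · simp [h0, h1, derivative']
    · rw [yablonskiiVorobev_add_two, h0, EuclideanDomain.div_one, mul_one]
  | succ n ih =>
    obtain ⟨⟨hf, df⟩, ⟨hg, dg⟩, hfg, H, hN⟩ := ih
    have H' := H.step_polynomial hg hN
    obtain ⟨mN, dN⟩ := todaNumerator_monic hg
    rw [← hN] at mN dN
    have hh : (yablonskiiVorobev (n + 2)).Monic := hf.of_mul_monic_right mN
    have hgh (z) (hz : (yablonskiiVorobev (n + 1)).eval z = 0) :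
        (yablonskiiVorobev (n + 2)).eval z ≠ 0 := by
      intro hz'
      have hfz : (yablonskiiVorobev n).eval z ≠ 0 := fun h => hfg z h hz
      -- At a common root of `Q_{n+1}` and `Q_{n+2}` the recurrence leaves only the square of
      -- `Q_{n+1}'`, which contradicts simplicity of the roots of `Q_{n+1}`.
      refine H.symm_C.eval_derivative_ne_zero hg.ne_zero hz hfz ?_
      have := congrArg (eval z) hN
      simpa [todaNumerator, derivative', hz, hz'] using this
    refine ⟨⟨hg, dg⟩, ⟨hh, ?_⟩, hgh, ?_, ?_⟩
    · rw [hh.natDegree_mul hf] at dN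
      -- Parity of `n * (n + 1)` turns the truncating halves into exact ones.
      obtain ⟨a, ha⟩ := Nat.even_mul_succ_self n
      have e1 : (n + 1) * (n + 2) = 2 * (a + n + 1) := by linear_combination ha
      have e2 : (n + 1 + 1) * (n + 1 + 2) = 2 * (a + 2 * n + 3) := by linear_combination ha
      rw [e1] at dg
      rw [ha] at df
      rw [e2]
      change (yablonskiiVorobev (n + 2)).natDegree = _
      omega
    · push_cast
      exact H'
    · rw [yablonskiiVorobev_add_two (n + 1), mul_comm]
      exact EuclideanDomain.mul_div_cancel' hg.ne_zero (H'.dvd_todaNumerator hg.ne_zero hh hgh)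

end YablonskiiVorobev

theorem mainTheorem4 (n : ℕ) (hn : 1 ≤ n) :
    -- the polynomials satisfy their defining equation, and have the right number of roots
    (yablonskiiVorobev (n + 1) * yablonskiiVorobev (n - 1) =
      X * yablonskiiVorobev n ^ 2
        - 4 * (yablonskiiVorobev n * derivative (derivative (yablonskiiVorobev n))
          - derivative (yablonskiiVorobev n) ^ 2)) ∧
    ((yablonskiiVorobev (n - 1)).roots.card = n * (n - 1) / 2 ∧
      (yablonskiiVorobev n).roots.card = n * (n + 1) / 2) ∧
    -- no denominator below vanishes
    (∀ z ∈ (yablonskiiVorobev (n - 1)).roots, ∀ w ∈ (yablonskiiVorobev n).roots, z ≠ w) ∧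
    -- sums over the roots of `Q_n`, at each root of `Q_{n-1}`
    (∀ z ∈ (yablonskiiVorobev (n - 1)).roots,
      rootSum n 2 z = -(z / 4) ∧
      rootSum n 3 z = ((n : ℂ) + 1) / 4 ∧
      rootSum n 5 z = -z * (((n : ℂ) + 1) / 24 - 1 / 48)) ∧
    -- sums over the roots of `Q_{n-1}`, at each root of `Q_n`
    (∀ z ∈ (yablonskiiVorobev n).roots,
      rootSum (n - 1) 2 z = -(z / 4) ∧
      rootSum (n - 1) 3 z = -(((n : ℂ) - 1) / 4) ∧
      rootSum (n - 1) 5 z = z * (((n : ℂ) - 1) / 24 + 1 / 48)) := by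
  obtain ⟨m, rfl⟩ : ∃ m, n = m + 1 := ⟨n - 1, by omega⟩
  obtain ⟨⟨hf, df⟩, ⟨hg, dg⟩, hfg, H, hN⟩ := yablonskiiVorobev_properties m
  simp only [Nat.add_sub_cancel]
  have hroots (p : ℂ[X]) : p.roots.card = p.natDegree :=
    (IsAlgClosed.splits p).natDegree_eq_card_roots.symm
  refine ⟨hN, ⟨by rw [hroots, df, mul_comm], by rw [hroots, dg]⟩, ?_, ?_, ?_⟩
  · rintro z hz w hw rfl
    exact hfg z (isRoot_of_mem_roots hz) (isRoot_of_mem_roots hw)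
  · intro z hz
    have h0 : (yablonskiiVorobev m).eval z = 0 := isRoot_of_mem_roots hz
    obtain ⟨h2, h3, h5⟩ := H.root_sums hf.ne_zero h0 (hfg z h0)
    refine ⟨h2, h3.trans ?_, h5.trans ?_⟩ <;> push_cast <;> ring
  · intro z hz
    have h0 : (yablonskiiVorobev (m + 1)).eval z = 0 := isRoot_of_mem_roots hz
    -- The reversed pair has parameter `-(m + 1)`.
    obtain ⟨h2, h3, h5⟩ := H.symm_C.root_sums hg.ne_zero h0 fun h => hfg z h h0
    refine ⟨h2, h3.trans ?_, h5.trans ?_⟩ <;> push_cast <;> ring
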